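/- **Theorem 2.** Let $n\ge 9$ and $p\ge 1$. *Model.* A dynamic graph is a sequence $\mathcal G_0,\mathcal G_1,\dots$ of connected simple graphs on a fixed set $V$ of $n$ nodes (1-interval connectivity); in each $\mathcal G_r$ the edges at a node $v$ carry distinct port numbers in $\{0,\dots,\deg_r(v)-1\}$, and edges and port numbers may change arbitrarily between rounds. A set of $k$ agents with distinct identifiers is placed on the nodes. In each round $r$ an adversary, who knows the algorithm, chooses $\mathcal G_r$ with its port numbers and a set of at most $p$ agents that are inactive in this round; every agent must be active in infinitely many rounds. Each active agent runs one communicate–compute–move cycle of a deterministic algorithm: it sees the port-labelled subgraph of $\mathcal G_r$ induced by its node and the neighbours of its node, with the identifiers of the agents on these nodes (1-hop visibility, which shows neither the memory of agents nor whether they are active), exchanges information with exactly the active agents on its own node (face-to-face communication), updates its memory, and then stays or moves through a port of its node. Inactive agents do nothing. Nodes have unique visible identifiers and unbounded storage, which active agents on the node read and write; agents have unbounded memory and know all parameters. A node is visited if some agent is on it at the beginning of some round. An algorithm achieves exploration if every node gets visited, from every initial placement and against every such adversary. A placement is in configuration $\mathcal C^*$ if exactly $n-2$ nodes hold $p+1$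 agents each and exactly one node holds a single agent. *Claim.* With $k=(n-2)(p+1)+1$ agents, no algorithm achieves exploration. More precisely, for every algorithm, every initial placement that is not in configuration $\mathcal C^*$, and every node $v$ that holds no agent initially, the adversary can act such that $v$ is never visited and the agents are not in configuration $\mathcal C^*$ at the beginning of any round. -/

import Mathlib

namespace DynExplore

universe u v w x

/-- One snapshot of a dynamic graph: a simple graph on the fixed node set `V` together with a port
labelling. The edges incident to a node `a` carry distinct port numbers in `{0, …, deg a - 1}`; the
two port numbers of an edge are unrelated. `port a b` has no meaning when `a`, `b` are not
adjacent. -/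
structure Snapshot (V : Type u) where
  graph : SimpleGraph V
  port : V → V → ℕ
  port_lt : ∀ a b, graph.Adj a b → port a b < (graph.neighborSet a).ncard
  port_inj : ∀ a b c, graph.Adj a b → graph.Adj a c → port a b = port a c → b = c

/-- The end point of a move decided at node `a`: `none` means staying, `some i` means leaving
through port `i` (a port number that does not exist at `a` has no effect). -/
noncomputable def Snapshot.target {V : Type u} (G : Snapshot V) (a : V) : Option ℕ → V
  | none => a
  | some i =>
    open Classical in
    if h : ∃ b, G.graph.Adj a b ∧ G.port a b = i then h.choose else a

/-- The closed neighbourhood of `a`: the nodes at distance at most one. -/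
def Snapshot.hood {V : Type u} (G : Snapshot V) (a : V) : Set V :=
  {b | b = a ∨ G.graph.Adj a b}

/-- A 1-hop view: the node at which the observer stands, the nodes within distance one, the
port-labelled subgraph induced by them, and the identifiers of the agents at each of them. Nodes
are visible with their identifiers. There is an edge from `b` to `c` in the view if and only if
`port b c` is not `none`. -/
structure View (V : Type u) (A : Type v) where
  center : V
  nodes : Set V
  port : V → V → Option ℕ
  agents : V → Set A

/-- The 1-hop view at node `a` in the snapshot `G`, when agent `i` is located at `pos i`. -/
noncomputable def view {V : Type u} {A : Type v} (G : Snapshot V) (pos : A → V) (a : V) :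
    View V A where
  center := a
  nodes := G.hood a
  port := fun b c =>
    open Classical in
    if b ∈ G.hood a ∧ c ∈ G.hood a ∧ G.graph.Adj b c then some (G.port b c) else none
  agents := fun b => {i | b ∈ G.hood a ∧ pos i = b}

/-- Everything that is available, in one round, to the active agents at a node: the 1-hop view, the
memory contents of the active agents at this same node (face-to-face communication; `none` for every
other agent), and the content of the storage of this node. -/
structure LocalInfo (V : Type u) (A : Type v) (M : Type w) (S : Type x) where
  view : View V A
  memory : A → Option M
  store : S

/-- A deterministic algorithm for agents with identifiers in `A` on nodes with identifiers in `V`,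
with face-to-face communication and 1-hop visibility. Agent memory `Mem` and node storage `Store`
are arbitrary types, hence unbounded; since the algorithm may be chosen for given `V`, `A` (and
given bound on the number of deactivations), all parameters are known. As the active agents at a
node share all their information, what they jointly write to the storage of the node is one function
of this information. -/
structure Algorithm (V : Type u) (A : Type v) where
  Mem : Type w
  Store : Type x
  initMem : A → Mem
  initStore : V → Store
  newMem : A → LocalInfo V A Mem Store → Mem
  move : A → LocalInfo V A Mem Store → Option ℕ
  newStore : LocalInfo V A Mem Store → Store

/-- A global state: positions and memories of the agents, storage contents of the nodes. -/
structure Config {V : Type u} {A : Type v} (alg : Algorithm.{u, v, w, x} V A) where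
  pos : A → V
  mem : A → alg.Mem
  store : V → alg.Store

/-- What the adversary decides: in each round, the snapshot and the set of deactivated agents. -/
structure Schedule (V : Type u) (A : Type v) where
  snap : ℕ → Snapshot V
  inactive : ℕ → Finset A

/-- The schedules of an adversary that deactivates at most `p` agents per round: every snapshot is
connected (1-interval connectivity) and every agent is active infinitely often (fairness). -/
structure Schedule.Admissible {V : Type u} {A : Type v} (p : ℕ) (S : Schedule V A) : Prop where
  connected : ∀ r, (S.snap r).graph.Connected
  card_inactive : ∀ r, (S.inactive r).card ≤ p
  fair : ∀ i, ∃ᶠ r in Filter.atTop, i ∉ S.inactive r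

section Execution

variable {V : Type u} {A : Type v} (alg : Algorithm.{u, v, w, x} V A)

/-- The information available to the active agents at node `a`. -/
noncomputable def localInfo (G : Snapshot V) (D : Finset A) (C : Config alg) (a : V) :
    LocalInfo V A alg.Mem alg.Store where
  view := view G C.pos a
  memory := fun i => open Classical in if i ∉ D ∧ C.pos i = a then some (C.mem i) else none
  store := C.store a

/-- One round (communicate, compute, move) in the snapshot `G` with the agents in `D` inactive.
Inactive agents keep position and memory; a node without active agents keeps its storage. -/
noncomputable def step (G : Snapshot V) (D : Finset A) (C : Config alg) : Config alg where
  pos := fun i =>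
    open Classical in
    if i ∈ D then C.pos i
    else G.target (C.pos i) (alg.move i (localInfo alg G D C (C.pos i)))
  mem := fun i =>
    open Classical in
    if i ∈ D then C.mem i else alg.newMem i (localInfo alg G D C (C.pos i))
  store := fun a =>
    open Classical in
    if ∃ i, i ∉ D ∧ C.pos i = a then alg.newStore (localInfo alg G D C a) else C.store a

/-- The state at the beginning of round `r`, from the initial placement `pos₀` of the agents. -/
noncomputable def run (S : Schedule V A) (pos₀ : A → V) : ℕ → Config alg
  | 0 => ⟨pos₀, alg.initMem, alg.initStore⟩
  | r + 1 => step alg (S.snap r) (S.inactive r) (run S pos₀ r)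

/-- The node `a` is visited at some time. -/
def Visited (S : Schedule V A) (pos₀ : A → V) (a : V) : Prop :=
  ∃ r i, (run alg S pos₀ r).pos i = a

/-- The algorithm achieves exploration against an adversary that deactivates at most `p` agents per
round: from every initial placement and under every admissible schedule all nodes get visited. -/
def AchievesExploration (p : ℕ) : Prop :=
  ∀ (pos₀ : A → V) (S : Schedule V A), S.Admissible p → ∀ a, Visited alg S pos₀ a

end Execution

/-- The number of agents at node `a`. -/
noncomputable def count {V : Type u} {A : Type v} (pos : A → V) (a : V) : ℕ :=
  {i | pos i = a}.ncard

/-- The configuration `C*`: exactly `n - 2` nodes hold `p + 1` agents each and exactly one node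
holds a single agent, where `n` is the number of nodes. -/
def IsCStar {V : Type u} {A : Type v} (p : ℕ) (pos : A → V) : Prop :=
  {a | count pos a = p + 1}.ncard = Nat.card V - 2 ∧ {a | count pos a = 1}.ncard = 1

end DynExplore

namespace DynExplore

open Finset
open scoped Classical

universe u v w x

/-! ### Moves and views in a snapshot; port numbers obtained from a ranking. -/

section Snapshots

variable {V : Type u}

/-! The adversary keeps `o` empty by hanging it as a leaf on a node `u` with at most `p` agents and
deactivating all of them. Outside `C*`, counting shows that `u` can be chosen so that no agent is
inactive twice in a row (`exists_light`), which gives fairness.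

It remains to stay outside `C*`. Two nodes `s`, `t` other than `o` do not hold `p + 1` agents
(`exists_two_count_ne`). The rest of the graph is a tree around a path `a, x, y, b`, and for each `Z
⊆ {s, t}` the nodes of `Z` can be hung on the side of `a`. The agents at `x` and `y` cannot see `Z`,
so the flow over the edge `x y` is the same for all four choices (`tree_step_pos_congr`). If every
choice led to `C*`, then, up to one common constant, the deficit of `Z` relative to `p + 1` agents
per node would always be `0` or `p`. The deficits of `s` and `t` are nonzero and add up, so four
such values are impossible. `exists_round` combines these facts and `exists_schedule` iterates them.
-/

theorem Snapshot.target_eq {G : Snapshot V} {a b : V} {i : ℕ} (h : G.graph.Adj a b)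
    (hi : G.port a b = i) : G.target a (some i) = b := by
  have hex : ∃ c, G.graph.Adj a c ∧ G.port a c = i := ⟨b, h, hi⟩
  simp only [Snapshot.target, dif_pos hex]
  exact G.port_inj a _ _ hex.choose_spec.1 h (hex.choose_spec.2.trans hi.symm)

theorem Snapshot.target_eq_self {G : Snapshot V} {a : V} {i : ℕ}
    (h : ¬ ∃ b, G.graph.Adj a b ∧ G.port a b = i) : G.target a (some i) = a := by
  simp only [Snapshot.target, dif_neg h]

theorem Snapshot.target_eq_or_adj (G : Snapshot V) (a : V) (o : Option ℕ) :
    G.target a o = a ∨ G.graph.Adj a (G.target a o) := by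
  rcases o with _ | i
  · exact Or.inl rfl
  · by_cases h : ∃ b, G.graph.Adj a b ∧ G.port a b = i
    · obtain ⟨b, hb, hi⟩ := h
      rw [Snapshot.target_eq hb hi]
      exact Or.inr hb
    · exact Or.inl (Snapshot.target_eq_self h)

/-- Moves from a node depend only on the incident edges and their port numbers. -/
theorem Snapshot.target_congr {G H : Snapshot V} {a : V}
    (hadj : ∀ b, G.graph.Adj a b ↔ H.graph.Adj a b)
    (hport : ∀ b, G.graph.Adj a b → G.port a b = H.port a b) (o : Option ℕ) :
    G.target a o = H.target a o := by
  rcases o with _ | i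
  · rfl
  · by_cases h : ∃ b, G.graph.Adj a b ∧ G.port a b = i
    · obtain ⟨b, hb, hi⟩ := h
      rw [Snapshot.target_eq hb hi, Snapshot.target_eq ((hadj b).1 hb) ((hport b hb).symm.trans hi)]
    · rw [Snapshot.target_eq_self h, Snapshot.target_eq_self]
      rintro ⟨b, hb, hi⟩
      exact h ⟨b, (hadj b).2 hb, (hport b ((hadj b).2 hb)).trans hi⟩

/-- The view at `a` depends only on the port-labelled subgraph induced by the closed neighbourhood
of `a`. -/
theorem view_congr {A : Type v} {G H : Snapshot V} {a : V}
    (hadj : ∀ b, G.graph.Adj a b ↔ H.graph.Adj a b)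
    (hadj' : ∀ b c, G.graph.Adj a b → G.graph.Adj a c → (G.graph.Adj b c ↔ H.graph.Adj b c))
    (hport : ∀ b, G.graph.Adj a b → G.port a b = H.port a b ∧ G.port b a = H.port b a)
    (hport' : ∀ b c, G.graph.Adj a b → G.graph.Adj a c → G.graph.Adj b c →
      G.port b c = H.port b c) (pos : A → V) :
    view G pos a = view H pos a := by
  have hh : G.hood a = H.hood a := by
    ext b
    simp only [Snapshot.hood, Set.mem_ofPred_eq, hadj]
  have key : ∀ b c, b ∈ G.hood a → c ∈ G.hood a →
      (G.graph.Adj b c ↔ H.graph.Adj b c) ∧ (G.graph.Adj b c → G.port b c = H.port b c) := by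
    rintro b c (rfl | hb) (rfl | hc)
    · simp
    · exact ⟨hadj c, fun h => (hport c h).1⟩
    · exact ⟨by rw [G.graph.adj_comm, H.graph.adj_comm]; exact hadj b, fun h => (hport b hb).2⟩
    · exact ⟨hadj' b c hb hc, hport' b c hb hc⟩
  unfold view
  congr 1
  · funext b c
    by_cases hb : b ∈ G.hood a
    · by_cases hc : c ∈ G.hood a
      · obtain ⟨k1, k2⟩ := key b c hb hc
        rw [← hh]
        by_cases h : G.graph.Adj b c
        · simp [hb, hc, h, k1.1 h, k2 h]
        · simp [hb, hc, h, mt k1.2 h]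
      · simp [← hh, hc]
    · simp [← hh, hb]
  · funext b
    rw [hh]

/-- The snapshot of a graph in which the edges at each node are numbered by the rank of their other
end point. -/
noncomputable def rankedSnapshot [Finite V] (g : SimpleGraph V) (rank : V → ℕ)
    (hr : Function.Injective rank) : Snapshot V where
  graph := g
  port a b := {c | g.Adj a c ∧ rank c < rank b}.ncard
  port_lt a b h := Set.ncard_lt_ncard
    ⟨fun _ hc => hc.1, fun hs => lt_irrefl _ (hs (show b ∈ g.neighborSet a from h)).2⟩
    (Set.toFinite _)
  port_inj a b c hb hc h := by
    by_contra hne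
    have aux : ∀ b c, g.Adj a b → rank b < rank c →
        {d | g.Adj a d ∧ rank d < rank b}.ncard < {d | g.Adj a d ∧ rank d < rank c}.ncard :=
      fun b c hb hlt => Set.ncard_lt_ncard
        ⟨fun d hd => ⟨hd.1, hd.2.trans hlt⟩,
          fun hs => lt_irrefl _ (hs (show b ∈ {d | g.Adj a d ∧ rank d < rank c} from ⟨hb, hlt⟩)).2⟩
        (Set.toFinite _)
    rcases lt_or_gt_of_ne (fun h' => hne (hr h')) with hlt | hlt
    · exact absurd h (aux b c hb hlt).ne
    · exact absurd h (aux c b hc hlt).ne'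

/-- Used with the path nodes `x`, `y` ranked lowest, so that the ports of their neighbours towards
them do not depend on what else hangs there. -/
theorem exists_rank_lt [Finite V] {s t : V} (hst : s ≠ t) :
    ∃ rank : V → ℕ, Function.Injective rank ∧ (∀ c, ¬ rank c < rank s) ∧
      ∀ c, rank c < rank t → c = s := by
  obtain ⟨m, ⟨e⟩⟩ := Finite.exists_equiv_fin V
  refine ⟨fun c => if c = s then 0 else if c = t then 1 else (e c : ℕ) + 2, ?_, ?_, ?_⟩
  · intro c d h
    dsimp only at h
    split_ifs at h <;> first | omega | simp_all
    exact e.injective (Fin.ext h)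
  · intro c
    simp
  · intro c h
    by_contra hc
    simp only [if_neg hc, if_neg hst.symm, if_true] at h
    split_ifs at h <;> omega

end Snapshots

/-! ### The adversary's trees. -/

section Trees

variable {V : Type u}

/-- The parent function of a tree with root `y`: it contains the path `a, x, y, b`; the node `o`
hangs off `u`, the nodes in `Z` hang off `a`, and all others hang off `b`. -/
noncomputable def parent (a x y b o u : V) (Z : Finset V) (c : V) : V :=
  if c = y ∨ c = x ∨ c = b then y else if c = a then x else if c = o then u
  else if c ∈ Z then a else b

/-- The tree with parent function `parent`. -/
def tree (a x y b o u : V) (Z : Finset V) : SimpleGraph V :=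
  SimpleGraph.fromRel fun c d => parent a x y b o u Z c = d

/-- The nodes `a`, `x`, `y`, `b`, `o` are distinct, and neither `u` nor a member of `Z` is among
them. -/
structure TreeNodes (a x y b o u : V) (Z : Finset V) : Prop where
  nodup : [a, x, y, b, o].Nodup
  u_notMem : u ∉ [a, x, y, b, o]
  notMem : ∀ c ∈ [a, x, y, b, o], c ∉ Z

variable {a x y b o u : V} {Z : Finset V}

theorem tree_adj {c d : V} : (tree a x y b o u Z).Adj c d ↔
    c ≠ d ∧ (parent a x y b o u Z c = d ∨ parent a x y b o u Z d = c) := by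
  simp [tree, SimpleGraph.fromRel_adj]

theorem tree_connected (h : TreeNodes a x y b o u Z) : (tree a x y b o u Z).Connected := by
  have hp : ∀ c, (tree a x y b o u Z).Reachable c (parent a x y b o u Z c) := by
    intro c
    by_cases hc : c = parent a x y b o u Z c
    · rw [← hc]
    · exact (tree_adj.2 ⟨hc, Or.inl rfl⟩).reachable
  obtain ⟨h1, h2, h3⟩ := h
  have hx : (tree a x y b o u Z).Reachable x y := by simpa [parent] using hp x
  have hb : (tree a x y b o u Z).Reachable b y := by simpa [parent] using hp b
  have ha : (tree a x y b o u Z).Reachable a y := by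
    have := hp a
    rw [show parent a x y b o u Z a = x by simp at h1; simp [parent]; grind] at this
    exact this.trans hx
  -- The leaf `o` comes last, since its parent `u` may lie on either side.
  have hne : ∀ c, c ≠ o → (tree a x y b o u Z).Reachable c y := by
    intro c hc
    have := hp c
    unfold parent at this
    split_ifs at this
    · exact this
    · exact this.trans hx
    · exact this.trans ha
    · exact this.trans hb
  have hall : ∀ c, (tree a x y b o u Z).Reachable c y := by
    intro c
    by_cases hc : c = o
    · subst hc
      have := hp c
      rw [show parent a x y b c u Z c = u by simp at h1; simp [parent]; grind] at this
      exact this.trans (hne u (by simp at h2; tauto))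
    · exact hne c hc
  exact (SimpleGraph.connected_iff _).2 ⟨fun c d => (hall c).trans (hall d).symm, ⟨y⟩⟩

theorem tree_adj_x (h : TreeNodes a x y b o u Z) (c : V) :
    (tree a x y b o u Z).Adj x c ↔ c = a ∨ c = y := by
  obtain ⟨h1, h2, h3⟩ := h
  simp at h1 h2 h3
  rw [tree_adj]
  unfold parent
  grind

theorem tree_adj_y (h : TreeNodes a x y b o u Z) (c : V) :
    (tree a x y b o u Z).Adj y c ↔ c = x ∨ c = b := by
  obtain ⟨h1, h2, h3⟩ := h
  simp at h1 h2 h3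
  rw [tree_adj]
  unfold parent
  grind

theorem tree_adj_o (h : TreeNodes a x y b o u Z) (c : V) :
    (tree a x y b o u Z).Adj c o ↔ c = u := by
  obtain ⟨h1, h2, h3⟩ := h
  simp at h1 h2 h3
  rw [tree_adj]
  unfold parent
  grind

theorem tree_not_adj_a_y (h : TreeNodes a x y b o u Z) : ¬ (tree a x y b o u Z).Adj a y := by
  rw [SimpleGraph.adj_comm, tree_adj_y h]
  have := h.nodup
  simp at this
  grind

theorem tree_not_adj_x_b (h : TreeNodes a x y b o u Z) : ¬ (tree a x y b o u Z).Adj x b := by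
  rw [tree_adj_x h]
  have := h.nodup
  simp at this
  grind

/-- Apart from the edge at `o`, only the edge `x y` leaves the set formed by `a`, `x` and `Z`. -/
theorem tree_adj_cross (h : TreeNodes a x y b o u Z) {c d : V}
    (hcd : (tree a x y b o u Z).Adj c d) (hc : c ∈ insert a (insert x Z))
    (hd : d ∉ insert a (insert x Z)) (hdo : d ≠ o) : c = x ∧ d = y := by
  obtain ⟨h1, h2, h3⟩ := h
  simp at h1 h2 h3 hc hd
  rw [tree_adj] at hcd
  unfold parent at hcd
  grind

end Trees

/-! ### Counting agents inside and outside `C*`. -/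

section Counting

theorem isCStar_of_count {V : Type u} {A : Type v} [Fintype V] {p : ℕ} (hp : 1 ≤ p)
    {pos : A → V} {o s : V} (hso : s ≠ o) (ho : count pos o = 0) (hs : count pos s = 1)
    (h : ∀ c, c ≠ o → c ≠ s → count pos c = p + 1) : IsCStar p pos := by
  constructor
  · rw [show {c | count pos c = p + 1} = ((({o, s} : Finset V)ᶜ : Finset V) : Set V) by
      ext c
      by_cases h1 : c = o
      · simp [h1, ho]
      · by_cases h2 : c = s
        · simp [h2, hs]; omega
        · simp [h1, h2, h c h1 h2], Set.ncard_coe_finset, Finset.card_compl,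
      Finset.card_pair hso.symm, Nat.card_eq_fintype_card]
  · rw [Set.ncard_eq_one]
    refine ⟨s, ?_⟩
    ext c
    by_cases h1 : c = o
    · simp [h1, ho, hso.symm]
    · by_cases h2 : c = s
      · simp [h2, hs]
      · simp [h2, h c h1 h2]; omega

variable {V : Type u} {A : Type v} [Fintype A]

theorem count_eq_card (pos : A → V) (c : V) : count pos c = #{i | pos i = c} := by
  rw [count, ← Set.ncard_coe_finset]
  simp

theorem card_filter_mem_eq_sum_count (pos : A → V) (S : Finset V) :
    #{i | pos i ∈ S} = ∑ c ∈ S, count pos c := by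
  rw [Finset.card_eq_sum_card_fiberwise (f := pos) (t := S) (by intro i; simp)]
  refine Finset.sum_congr rfl fun c hc => ?_
  rw [count_eq_card, Finset.filter_filter]
  congr 1
  ext i
  simp only [mem_filter, mem_univ, true_and]
  exact ⟨And.right, fun h => ⟨h ▸ hc, h⟩⟩

/-- If all traffic between `S` and its complement uses the edge `x y`, the change of the number of
agents in `S` is the net flow over this edge. -/
theorem card_filter_mem_add_flow {pos pos' : A → V} {S : Finset V} {x y : V} (hx : x ∈ S)
    (hy : y ∉ S) (hout : ∀ i, pos i ∈ S → pos' i ∉ S → pos i = x ∧ pos' i = y)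
    (hin : ∀ i, pos i ∉ S → pos' i ∈ S → pos i = y ∧ pos' i = x) :
    #{i | pos' i ∈ S} + #{i | pos i = x ∧ pos' i = y} =
      #{i | pos i ∈ S} + #{i | pos i = y ∧ pos' i = x} := by
  simp only [Finset.card_filter, ← Finset.sum_add_distrib]
  refine Finset.sum_congr rfl fun i _ => ?_
  have h1 := hout i
  have h2 := hin i
  grind

theorem count_eq_zero {pos : A → V} {o : V} (ho : ∀ i, pos i ≠ o) : count pos o = 0 := by
  simp [count_eq_card, ho]

variable [Fintype V]

theorem sum_count_erase {pos : A → V} {o : V} (ho : ∀ i, pos i ≠ o) :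
    ∑ c ∈ univ.erase o, count pos c = Fintype.card A := by
  rw [← card_filter_mem_eq_sum_count]
  simp [ho]

/-- In the configuration `C*` with `o` empty, every set of nodes without `o` holds `p + 1` agents
per node, except that `p` agents may be missing. -/
theorem IsCStar.sum_count {p : ℕ} (hp : 1 ≤ p) {pos : A → V} {o : V} (ho : ∀ i, pos i ≠ o)
    (h : IsCStar p pos) {S : Finset V} (hS : o ∉ S) :
    ∑ c ∈ S, count pos c = #S * (p + 1) ∨ ∑ c ∈ S, count pos c + p = #S * (p + 1) := by
  obtain ⟨h1, h2⟩ := h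
  obtain ⟨s, hs⟩ := Set.ncard_eq_one.1 h2
  have hs1 : count pos s = 1 := by
    have : s ∈ {c | count pos c = 1} := by rw [hs]; rfl
    exact this
  have ho0 := count_eq_zero ho
  have hso : s ≠ o := fun h => by rw [h] at hs1; omega
  have hall : ∀ c, c ≠ o → c ≠ s → count pos c = p + 1 := by
    -- Both sets have `n - 2` elements, so the inclusion is an equality.
    have hsub : univ.filter (fun c => count pos c = p + 1) ⊆ ({o, s} : Finset V)ᶜ := by
      intro c hc
      simp only [mem_filter, mem_univ, true_and] at hc
      simp only [mem_compl, mem_insert, mem_singleton, not_or]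
      constructor <;> rintro rfl <;> omega
    have heq := Finset.eq_of_subset_of_card_le hsub (by
      rw [Finset.card_compl, Finset.card_pair hso.symm, ← Nat.card_eq_fintype_card, ← h1,
        ← Set.ncard_coe_finset]
      simp)
    intro c hco hcs
    have : c ∈ ({o, s} : Finset V)ᶜ := by simp [hco, hcs]
    rw [← heq] at this
    simpa using this
  by_cases hsS : s ∈ S
  · right
    rw [← Finset.add_sum_erase S _ hsS, hs1, Finset.sum_congr rfl (g := fun _ => p + 1)]
    · rw [Finset.sum_const, Finset.card_erase_of_mem hsS, smul_eq_mul]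
      have : 1 ≤ #S := Finset.card_pos.2 ⟨s, hsS⟩
      obtain ⟨m, hm⟩ := Nat.exists_eq_add_of_le this
      rw [hm, Nat.add_sub_cancel_left]
      ring
    · intro c hc
      rw [mem_erase] at hc
      exact hall c (fun h => hS (h ▸ hc.2)) hc.1
  · left
    rw [Finset.sum_congr rfl (g := fun _ => p + 1), Finset.sum_const, smul_eq_mul]
    intro c hc
    exact hall c (fun h => hS (h ▸ hc)) (fun h => hsS (h ▸ hc))

variable {n p : ℕ} (hn : 2 ≤ n) (hp : 1 ≤ p) (hV : Fintype.card V = n)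
  (hA : Fintype.card A = (n - 2) * (p + 1) + 1) {pos : A → V} {o : V} (ho : ∀ i, pos i ≠ o)
  (hC : ¬ IsCStar p pos)

include hn hp hV hA ho hC

/-- With no exceptional node the total would be too large; with only one, the total leaves it a
single agent, which is `C*`. -/
theorem exists_two_count_ne : ∃ s t, s ≠ t ∧ s ≠ o ∧ t ≠ o ∧ count pos s ≠ p + 1 ∧
    count pos t ≠ p + 1 := by
  by_contra! hcon
  have hsum := sum_count_erase ho
  have hcard : #(univ.erase o) = n - 1 := by rw [card_erase_of_mem (mem_univ _), card_univ, hV]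
  obtain ⟨m, rfl⟩ := Nat.exists_eq_add_of_le hn
  rw [Nat.add_sub_cancel_left] at hA
  have hex : ∃ s, s ≠ o ∧ count pos s ≠ p + 1 := by
    by_contra! hall
    rw [Finset.sum_congr rfl (g := fun _ => p + 1) (fun c hc => hall c (ne_of_mem_erase hc)),
      Finset.sum_const, hcard, hA, smul_eq_mul, show 2 + m - 1 = m + 1 by omega] at hsum
    linarith
  obtain ⟨s, hso, hs⟩ := hex
  have hall : ∀ c, c ≠ o → c ≠ s → count pos c = p + 1 := fun c hco hcs =>
    by_contra fun hc => hc (hcon s c (Ne.symm hcs) hso hco hs)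
  refine hC (isCStar_of_count hp hso (count_eq_zero ho) ?_ hall)
  have hmem : s ∈ univ.erase o := mem_erase.2 ⟨hso, mem_univ _⟩
  rw [← Finset.add_sum_erase _ _ hmem, Finset.sum_congr rfl (g := fun _ => p + 1)
      (fun c hc => hall c (ne_of_mem_erase (mem_of_mem_erase hc)) (ne_of_mem_erase hc)),
    Finset.sum_const, card_erase_of_mem hmem, hcard, hA, smul_eq_mul,
    show 2 + m - 1 - 1 = m by omega] at hsum
  linarith

/-- Otherwise all nodes but `o` and `w` hold at least `p + 1` agents and `w`, if it is not `o`, at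
least one. The total then forces equality everywhere, hence `C*`. -/
theorem exists_light (w : V) : ∃ c, c ≠ o ∧ count pos c ≤ p ∧ (c = w → count pos c = 0) := by
  by_contra! hcon
  have hsum := sum_count_erase ho
  have hcard : #(univ.erase o) = n - 1 := by rw [card_erase_of_mem (mem_univ _), card_univ, hV]
  obtain ⟨m, rfl⟩ := Nat.exists_eq_add_of_le hn
  rw [Nat.add_sub_cancel_left] at hA
  have hheavy : ∀ c, c ≠ o → c ≠ w → p + 1 ≤ count pos c := fun c hco hcw => by
    by_contra hc
    exact hcw (hcon c hco (by omega)).1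
  by_cases hwo : w = o
  · have := Finset.card_nsmul_le_sum (univ.erase o) (count pos) (p + 1)
      (fun c hc => hheavy c (ne_of_mem_erase hc) (hwo ▸ ne_of_mem_erase hc))
    rw [hsum, hcard, hA, smul_eq_mul, show 2 + m - 1 = m + 1 by omega] at this
    linarith
  have hw1 : 1 ≤ count pos w := by
    by_contra hc
    exact (hcon w hwo (by omega)).2 (by omega)
  have hmem : w ∈ univ.erase o := mem_erase.2 ⟨hwo, mem_univ _⟩
  have hcard' : #((univ.erase o).erase w) = m := by
    rw [card_erase_of_mem hmem, hcard]; omega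
  have hle : ∀ c ∈ (univ.erase o).erase w, p + 1 ≤ count pos c := fun c hc =>
    hheavy c (ne_of_mem_erase (mem_of_mem_erase hc)) (ne_of_mem_erase hc)
  have hge : _ ≤ ∑ c ∈ (univ.erase o).erase w, count pos c :=
    Finset.card_nsmul_le_sum _ (count pos) (p + 1) hle
  rw [← Finset.add_sum_erase _ _ hmem, hA] at hsum
  rw [hcard', smul_eq_mul] at hge
  refine hC (isCStar_of_count hp hwo (count_eq_zero ho) (by omega) fun c hco hcw => ?_)
  have heq : ∑ c ∈ (univ.erase o).erase w, (p + 1) = ∑ c ∈ (univ.erase o).erase w, count pos c := by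
    rw [Finset.sum_const, hcard', smul_eq_mul]
    omega
  exact ((Finset.sum_eq_sum_iff_of_le hle).1 heq c
    (mem_erase.2 ⟨hcw, mem_erase.2 ⟨hco, mem_univ _⟩⟩)).symm

end Counting

/-! ### One round of the adversary. -/

section Rounds

variable {V : Type u} {A : Type v} {alg : Algorithm.{u, v, w, x} V A}

theorem step_pos_of_mem {G : Snapshot V} {D : Finset A} {C : Config alg} {i : A} (h : i ∈ D) :
    (step alg G D C).pos i = C.pos i := by
  simp [step, h]

theorem step_pos_eq_or_adj (G : Snapshot V) (D : Finset A) (C : Config alg) (i : A) :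
    (step alg G D C).pos i = C.pos i ∨ G.graph.Adj (C.pos i) ((step alg G D C).pos i) := by
  by_cases h : i ∈ D
  · exact Or.inl (step_pos_of_mem h)
  · simp only [step, if_neg h]
    exact G.target_eq_or_adj _ _

/-- Agents at `c` behave alike in two snapshots with the same port-labelled triangle-free closed
neighbourhood of `c`. -/
theorem step_pos_congr {G H : Snapshot V} (D : Finset A) (C : Config alg) {c : V}
    (hadj : ∀ b, G.graph.Adj c b ↔ H.graph.Adj c b)
    (hG : ∀ b d, G.graph.Adj c b → G.graph.Adj c d → ¬ G.graph.Adj b d)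
    (hH : ∀ b d, H.graph.Adj c b → H.graph.Adj c d → ¬ H.graph.Adj b d)
    (hport : ∀ b, G.graph.Adj c b → G.port c b = H.port c b ∧ G.port b c = H.port b c)
    {i : A} (hi : C.pos i = c) : (step alg G D C).pos i = (step alg H D C).pos i := by
  by_cases h : i ∈ D
  · rw [step_pos_of_mem h, step_pos_of_mem h]
  · have hview : view G C.pos c = view H C.pos c :=
      view_congr hadj
        (fun b d hb hd => iff_of_false (hG b d hb hd) (hH b d ((hadj b).1 hb) ((hadj d).1 hd)))
        hport (fun b d hb hd hbd => absurd hbd (hG b d hb hd)) C.pos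
    simp only [step, if_neg h, hi, localInfo, hview]
    exact Snapshot.target_congr hadj (fun b hb => (hport b hb).1) _

section TreeRound

variable [Finite V] {a x y b o u : V} {Z : Finset V} {rank : V → ℕ}
  (hr : Function.Injective rank)

theorem tree_step_pos_ne (h : TreeNodes a x y b o u Z) {D : Finset A} {C : Config alg}
    (ho : ∀ i, C.pos i ≠ o) (hD : ∀ i, C.pos i = u → i ∈ D) (i : A) :
    (step alg (rankedSnapshot (tree a x y b o u Z) rank hr) D C).pos i ≠ o := by
  intro hi
  rcases step_pos_eq_or_adj (rankedSnapshot (tree a x y b o u Z) rank hr) D C i with h' | h'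
  · exact ho i (h'.symm.trans hi)
  · rw [hi] at h'
    rw [step_pos_of_mem (hD i ((tree_adj_o h _).1 h'))] at hi
    exact ho i hi

/-- The edge `u o` carries no traffic, so `x y` is the only edge in use between the side of `a` and
the rest. -/
theorem tree_step_flow [Fintype A] (h : TreeNodes a x y b o u Z) {D : Finset A} {C : Config alg}
    (ho : ∀ i, C.pos i ≠ o) (hD : ∀ i, C.pos i = u → i ∈ D) :
    let pos' := (step alg (rankedSnapshot (tree a x y b o u Z) rank hr) D C).pos
    ∑ c ∈ insert a (insert x Z), count pos' c + #{i | C.pos i = x ∧ pos' i = y} =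
      ∑ c ∈ insert a (insert x Z), count C.pos c + #{i | C.pos i = y ∧ pos' i = x} := by
  intro pos'
  have ho' : ∀ i, pos' i ≠ o := tree_step_pos_ne hr h ho hD
  have hadj : ∀ i, pos' i = C.pos i ∨ (tree a x y b o u Z).Adj (C.pos i) (pos' i) :=
    step_pos_eq_or_adj _ D C
  rw [← card_filter_mem_eq_sum_count, ← card_filter_mem_eq_sum_count]
  apply card_filter_mem_add_flow
  · simp
  · have h1 := h.nodup
    have h2 := h.notMem y (by simp)
    simp at h1 ⊢
    grind
  · intro i hi hi'
    rcases hadj i with he | he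
    · exact absurd (he ▸ hi) hi'
    · exact tree_adj_cross h he hi hi' (ho' i)
  · intro i hi hi'
    rcases hadj i with he | he
    · exact absurd (he ▸ hi') hi
    · exact (tree_adj_cross h he.symm hi' hi (ho i)).symm

variable {Z' : Finset V} (hx : ∀ c, ¬ rank c < rank x) (hy : ∀ c, rank c < rank y → c = x)

include hx hy

/-- The degrees of `a` and `b` depend on `Z`, but `x` and `y` see only the ports of `a` and `b`
leading to them, and the ranking makes these `0`. -/
theorem tree_step_pos_congr (h : TreeNodes a x y b o u Z) (h' : TreeNodes a x y b o u Z')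
    (D : Finset A) (C : Config alg) {i : A} (hi : C.pos i = x ∨ C.pos i = y) :
    (step alg (rankedSnapshot (tree a x y b o u Z) rank hr) D C).pos i =
      (step alg (rankedSnapshot (tree a x y b o u Z') rank hr) D C).pos i := by
  have nay := fun {Z} (h : TreeNodes a x y b o u Z) => tree_not_adj_a_y h
  have nxb := fun {Z} (h : TreeNodes a x y b o u Z) => tree_not_adj_x_b h
  have px : ∀ Z c, (rankedSnapshot (tree a x y b o u Z) rank hr).port c x = 0 := by
    intro Z c
    simp [rankedSnapshot, hx]
  rcases hi with hi | hi
  · have hadj : ∀ c, (tree a x y b o u Z).Adj x c ↔ (tree a x y b o u Z').Adj x c := fun c => by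
      rw [tree_adj_x h, tree_adj_x h']
    have tri : ∀ {Z}, TreeNodes a x y b o u Z → ∀ c d, (tree a x y b o u Z).Adj x c →
        (tree a x y b o u Z).Adj x d → ¬ (tree a x y b o u Z).Adj c d := by
      intro Z h c d hc hd
      rw [tree_adj_x h] at hc hd
      rcases hc with rfl | rfl <;> rcases hd with rfl | rfl
      · simp
      · exact nay h
      · exact fun e => nay h e.symm
      · simp
    refine step_pos_congr D C hadj (tri h) (tri h') (fun c _ => ⟨?_, ?_⟩) hi
    · simp only [rankedSnapshot, hadj]
    · rw [px, px]
  · have hadj : ∀ c, (tree a x y b o u Z).Adj y c ↔ (tree a x y b o u Z').Adj y c := fun c => by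
      rw [tree_adj_y h, tree_adj_y h']
    have tri : ∀ {Z}, TreeNodes a x y b o u Z → ∀ c d, (tree a x y b o u Z).Adj y c →
        (tree a x y b o u Z).Adj y d → ¬ (tree a x y b o u Z).Adj c d := by
      intro Z h c d hc hd
      rw [tree_adj_y h] at hc hd
      rcases hc with rfl | rfl <;> rcases hd with rfl | rfl
      · simp
      · exact nxb h
      · exact fun e => nxb h e.symm
      · simp
    have py : ∀ {Z}, TreeNodes a x y b o u Z → ∀ c, (tree a x y b o u Z).Adj y c →
        (rankedSnapshot (tree a x y b o u Z) rank hr).port c y = 0 := by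
      intro Z h c hc
      have : {d | (tree a x y b o u Z).Adj c d ∧ rank d < rank y} = ∅ := by
        ext d
        simp only [Set.mem_ofPred_eq, Set.mem_empty_iff_false, iff_false, not_and]
        intro hd hlt
        have hdx := hy d hlt
        subst hdx
        rcases (tree_adj_y h c).1 hc with rfl | rfl
        · exact hd.ne rfl
        · exact nxb h hd.symm
      simp only [rankedSnapshot, this, Set.ncard_empty]
    refine step_pos_congr D C hadj (tri h) (tri h') (fun c hc => ⟨?_, ?_⟩) hi
    · simp only [rankedSnapshot, hadj]
    · exact (py h c hc).trans (py h' c ((hadj c).1 hc)).symm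

end TreeRound

theorem exists_round [Fintype V] [Fintype A] {n p : ℕ} (hn : 8 ≤ n) (hp : 1 ≤ p)
    (hV : Fintype.card V = n) (hA : Fintype.card A = (n - 2) * (p + 1) + 1) (C : Config alg)
    {o : V} (ho : ∀ i, C.pos i ≠ o) (hC : ¬ IsCStar p C.pos) (w : V) :
    ∃ (G : Snapshot V) (D : Finset A) (u : V), G.graph.Connected ∧ #D ≤ p ∧
      (∀ i ∈ D, C.pos i ≠ w) ∧ (∀ i ∈ D, C.pos i = u) ∧
      (∀ i, (step alg G D C).pos i ≠ o) ∧ ¬ IsCStar p (step alg G D C).pos := by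
  obtain ⟨u, huo, hup, huw⟩ := exists_light (by omega) hp hV hA ho hC w
  obtain ⟨s, t, hst, hso, hto, hs, ht⟩ := exists_two_count_ne (by omega) hp hV hA ho hC
  -- Eight nodes suffice: `s`, `t`, `u`, `o` (where `u` may equal `s` or `t`) and the path `a, x, y,
  -- b`.
  have hfresh : ∀ F : Finset V, #F < 8 → ∃ c, c ∉ F := fun F hF => by
    by_contra! hall
    have := Finset.card_le_card (fun c _ => hall c : (univ : Finset V) ⊆ F)
    rw [card_univ, hV] at this
    omega
  obtain ⟨a, ha⟩ := hfresh {s, t, u, o} (card_le_four.trans_lt (by norm_num))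
  obtain ⟨x, hx⟩ := hfresh {a, s, t, u, o} (card_le_five.trans_lt (by norm_num))
  obtain ⟨y, hy⟩ := hfresh {x, a, s, t, u, o} (card_le_six.trans_lt (by norm_num))
  obtain ⟨b, hb⟩ := hfresh {y, x, a, s, t, u, o}
    (((card_insert_le _ _).trans (Nat.succ_le_succ card_le_six)).trans_lt (by norm_num))
  simp only [mem_insert, mem_singleton, not_or] at ha hx hy hb
  have hnodes : ∀ Z ⊆ ({s, t} : Finset V), TreeNodes a x y b o u Z := by
    intro Z hZ
    refine ⟨by simp; grind, by simp; grind, fun c hc hcZ => ?_⟩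
    have := hZ hcZ
    simp at hc this
    grind
  have hxy : x ≠ y := fun h => hy.1 h.symm
  obtain ⟨rank, hr, hrx, hry⟩ := exists_rank_lt hxy
  set D : Finset A := univ.filter fun i => C.pos i = u with hDdef
  have hD : ∀ i, C.pos i = u → i ∈ D := fun i hi => by simp [hDdef, hi]
  have hDu : ∀ i ∈ D, C.pos i = u := fun i hi => by simpa [hDdef] using hi
  have hDcard : #D = count C.pos u := (count_eq_card _ _).symm
  suffices hZ : ∃ Z ⊆ ({s, t} : Finset V),
      ¬ IsCStar p (step alg (rankedSnapshot (tree a x y b o u Z) rank hr) D C).pos by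
    obtain ⟨Z, hZ, hZC⟩ := hZ
    refine ⟨_, D, u, tree_connected (hnodes Z hZ), hDcard.trans_le hup, fun i hi hiw => ?_, hDu,
      tree_step_pos_ne hr (hnodes Z hZ) ho hD, hZC⟩
    -- If `u = w`, then `u` is empty and nobody is deactivated.
    have h0 := huw ((hDu i hi).symm.trans hiw)
    rw [← hDcard, Finset.card_eq_zero] at h0
    simp [h0] at hi
  by_contra! hcon
  -- `f` is the flow from `x` to `y`; `g` is the reverse flow plus the agents initially at `a` and
  -- `x`. Both are computed for `Z = ∅` and serve every `Z`.
  obtain ⟨f, g, hfg⟩ : ∃ f g : ℕ, ∀ Z ⊆ ({s, t} : Finset V),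
      (#Z + 2) * (p + 1) + f = ∑ c ∈ Z, count C.pos c + g ∨
      (#Z + 2) * (p + 1) + f = ∑ c ∈ Z, count C.pos c + g + p := by
    refine ⟨#{i | C.pos i = x ∧
        (step alg (rankedSnapshot (tree a x y b o u ∅) rank hr) D C).pos i = y},
      count C.pos a + count C.pos x + #{i | C.pos i = y ∧
        (step alg (rankedSnapshot (tree a x y b o u ∅) rank hr) D C).pos i = x}, fun Z hZ => ?_⟩
    have hN := hnodes Z hZ
    have hflow := tree_step_flow (alg := alg) hr hN ho hD
    have haZ : a ∉ insert x Z := by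
      rw [mem_insert, not_or]
      exact ⟨fun h => hx.1 h.symm, hN.notMem a (by simp)⟩
    have hxZ : x ∉ Z := hN.notMem x (by simp)
    have hoS : o ∉ insert a (insert x Z) := by
      have := hN.notMem o (by simp)
      simp only [mem_insert, not_or]
      grind
    have hstar := (hcon Z hZ).sum_count hp (tree_step_pos_ne hr hN ho hD) hoS
    have hcongr := fun i hi => tree_step_pos_congr (alg := alg) hr hrx hry hN
      (hnodes ∅ (by simp)) D C (i := i) hi
    have e1 := Finset.filter_congr (s := univ) fun i _ => and_congr_right fun (hi : C.pos i = x) =>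
      Eq.congr_left (z := y) (hcongr i (Or.inl hi))
    have e2 := Finset.filter_congr (s := univ) fun i _ => and_congr_right fun (hi : C.pos i = y) =>
      Eq.congr_left (z := x) (hcongr i (Or.inr hi))
    dsimp only at hflow
    rw [e1, e2, Finset.sum_insert haZ (f := count C.pos), Finset.sum_insert hxZ] at hflow
    rw [card_insert_of_notMem haZ, card_insert_of_notMem hxZ] at hstar
    have : #Z + 2 = #Z + 1 + 1 := rfl
    rw [this]
    omega
  -- Nonzero differences between values in `{0, p}` are `p` or `-p`; adding both deficits to the
  -- value for `∅` would leave `{0, p}`.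
  have h0 := hfg ∅ (by simp)
  have h1 := hfg {s} (by simp)
  have h2 := hfg {t} (by simp)
  have h3 := hfg {s, t} subset_rfl
  rw [Finset.card_pair hst, Finset.sum_pair hst] at h3
  simp only [card_empty, card_singleton, sum_empty, sum_singleton] at h0 h1 h2
  ring_nf at h0 h1 h2 h3
  omega

end Rounds

/-! ### The infinite schedule. -/

/-- Gathering all agents at one node does not give the configuration `C*`. -/
theorem not_isCStar_const {V : Type u} {A : Type v} [Fintype V] {p : ℕ}
    (hV : 4 ≤ Fintype.card V) (hp : 1 ≤ p) (s : V) : ¬ IsCStar p (fun _ : A => s) := by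
  rintro ⟨h, -⟩
  have hsub : {c | count (fun _ : A => s) c = p + 1} ⊆ {s} := by
    intro c hc
    by_contra hcs
    have h0 : count (fun _ : A => s) c = 0 := by
      simp [count, show s ≠ c from fun h => hcs h.symm]
    simp only [Set.mem_ofPred_eq, h0] at hc
    omega
  have := Set.ncard_le_ncard hsub (Set.toFinite _)
  rw [h, Set.ncard_singleton, Nat.card_eq_fintype_card] at this
  omega

theorem exists_schedule {V : Type u} {A : Type v} [Fintype V] [Fintype A] {n p : ℕ} (hn : 8 ≤ n)
    (hp : 1 ≤ p) (hV : Fintype.card V = n) (hA : Fintype.card A = (n - 2) * (p + 1) + 1)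
    (alg : Algorithm.{u, v, w, x} V A) {pos₀ : A → V} {o : V} (ho : ∀ i, pos₀ i ≠ o)
    (hC : ¬ IsCStar p pos₀) :
    ∃ S : Schedule V A, S.Admissible p ∧ ¬ Visited alg S pos₀ o ∧
      ∀ r, ¬ IsCStar p (run alg S pos₀ r).pos := by
  -- A state: a configuration, and the node whose agents were inactive in the previous round.
  let State := {s : Config alg × V // (∀ i, s.1.pos i ≠ o) ∧ ¬ IsCStar p s.1.pos}
  choose G D u hconn hcard havoid hat hne hstar using
    fun s : State => exists_round hn hp hV hA s.1.1 s.2.1 s.2.2 s.1.2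
  let next : State → State := fun s => ⟨(step alg (G s) (D s) s.1.1, u s), hne s, hstar s⟩
  -- No round precedes the first, so the node to avoid is set to the empty node `o`.
  let init : State := ⟨(⟨pos₀, alg.initMem, alg.initStore⟩, o), ho, hC⟩
  let st : ℕ → State := fun r => next^[r] init
  have hst : ∀ r, st (r + 1) = next (st r) := fun r => Function.iterate_succ_apply' _ _ _
  let S : Schedule V A := ⟨fun r => G (st r), fun r => D (st r)⟩
  have hrun : ∀ r, run alg S pos₀ r = (st r).1.1 := by
    intro r
    induction r with
    | zero => rfl
    | succ r ih =>
      rw [run, ih, hst]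
  have hfair : ∀ i r, i ∈ D (st r) → i ∉ D (st (r + 1)) := by
    intro i r hi hi'
    -- An inactive agent is still at the recorded node one round later, and the agents there are not
    -- deactivated again.
    refine havoid (st (r + 1)) i hi' ?_
    rw [hst]
    exact (step_pos_of_mem hi).trans (hat _ i hi)
  refine ⟨S, ⟨fun r => hconn _, fun r => hcard _, fun i => ?_⟩, ?_, fun r => ?_⟩
  · rw [Filter.frequently_atTop]
    intro r
    by_cases hi : i ∈ D (st r)
    · exact ⟨r + 1, by omega, hfair i r hi⟩
    · exact ⟨r, le_rfl, hi⟩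
  · rintro ⟨r, i, hi⟩
    rw [hrun] at hi
    exact (st r).2.1 i hi
  · rw [hrun]
    exact (st r).2.2

end DynExplore

theorem theorem2 (n p : ℕ) (hn : 9 ≤ n) (hp : 1 ≤ p)
    {V : Type*} [Fintype V] (hV : Fintype.card V = n)
    {A : Type*} [Fintype A] (hA : Fintype.card A = (n - 2) * (p + 1) + 1)
    (alg : DynExplore.Algorithm V A) :
    ¬ DynExplore.AchievesExploration alg p ∧
    ∀ (pos₀ : A → V) (v : V), (∀ i, pos₀ i ≠ v) → ¬ DynExplore.IsCStar p pos₀ →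
      ∃ S : DynExplore.Schedule V A, S.Admissible p ∧
        ¬ DynExplore.Visited alg S pos₀ v ∧
        ∀ r, ¬ DynExplore.IsCStar p (DynExplore.run alg S pos₀ r).pos := by
  have key := fun pos₀ v => DynExplore.exists_schedule (pos₀ := pos₀) (o := v) (by omega) hp hV hA alg
  refine ⟨fun hex => ?_, key⟩
  obtain ⟨s, v, hsv⟩ := Fintype.exists_pair_of_one_lt_card (α := V) (by omega)
  obtain ⟨S, hS, hvis, -⟩ := key (fun _ => s) v (fun _ => hsv)
    (DynExplore.not_isCStar_const (by omega) hp s)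
  exact hvis (hex _ S hS v)
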